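/- All algebras are associative and not necessarily unital. A $*$-algebra is an algebra $A$ over $\mathbb{C}$ with a map $^*:A\to A$ satisfying $(a^*)^*=a$, $(a+b)^*=a^*+b^*$, $(ab)^*=b^*a^*$ and $(\lambda a)^*=\overline{\lambda}a^*$ for all $a,b\in A$, $\lambda\in\mathbb{C}$. It is called algebraic if every element $a\in A$ generates a finite dimensional subalgebra, and it is called a Baer $*$-algebra if for every non-empty subset $S\subseteq A$ there is a projection $f=f^*=f^2$ in $A$ such that $\{y\in A : ay=0 \text{ for all } a\in S\}=fA$. A Stonean space is a compact Hausdorff space in which the closure of every open set is open (the empty space is allowed). Theorem. Let $B$ be a commutative $*$-algebra. The following statements are equivalent. (i) $B$ is an algebraic Baer $*$-algebra, that is, $B$ is algebraic and is a Baer $*$-algebra. (ii) There exists a Stonean space $T$ such that $B$ is $*$-isomorphic to the linear span over $\mathbb{C}$ of the characteristic functions $\chi_U:T\to\mathbb{C}$ of the clopen sets $U\subseteq T$, a $*$-algebra under the pointwise operations and complex conjugation. -/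

import Mathlib

universe u

/-- An algebra over `ℂ`, associative and not necessarily unital, is algebraic if every element
generates a finite dimensional (not necessarily unital) subalgebra. -/
def IsAlgebraicAlgebra (A : Type*) [NonUnitalRing A] [Module ℂ A] [IsScalarTower ℂ A A]
    [SMulCommClass ℂ A A] : Prop :=
  ∀ a : A, FiniteDimensional ℂ (NonUnitalAlgebra.adjoin ℂ ({a} : Set A))

/-- The right annihilator of a subset of a ring (not necessarily unital). -/
def rightAnnihilator {A : Type*} [NonUnitalRing A] (S : Set A) : Set A :=
  {y : A | ∀ a ∈ S, a * y = 0}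

/-- A (not necessarily unital) ring with involution is a Baer `*`-ring if the right annihilator of
every nonempty subset is of the form `fA` with a projection `f`, i.e. `f = f* = f²`. -/
def IsBaerStarRing (A : Type*) [NonUnitalRing A] [StarRing A] : Prop :=
  ∀ S : Set A, S.Nonempty →
    ∃ f : A, IsStarProjection f ∧ rightAnnihilator S = Set.range (fun y : A => f * y)

/-- The characteristic functions `T → ℂ` of the clopen subsets of a topological space `T`. -/
def clopenCharFns (T : Type*) [TopologicalSpace T] : Set (T → ℂ) :=
  {g | ∃ U : Set T, IsClopen U ∧ g = U.indicator (fun _ => (1 : ℂ))}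

/-- The linear span of the characteristic functions of the clopen subsets of `T`, as a
`*`-subalgebra of `T → ℂ` with its pointwise operations. -/
def clopenSpan (T : Type*) [TopologicalSpace T] : StarSubalgebra ℂ (T → ℂ) where
  carrier := Submodule.span ℂ (clopenCharFns T)
  add_mem' := fun ha hb => Submodule.add_mem _ ha hb
  mul_mem' := fun {a b} ha hb => by
    simp only [SetLike.mem_coe] at ha hb ⊢
    have hab := Submodule.mul_mem_mul ha hb
    rw [Submodule.span_mul_span] at hab
    refine Submodule.span_mono ?_ hab
    rintro _ ⟨_, ⟨U, hU, rfl⟩, _, ⟨V, hV, rfl⟩, rfl⟩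
    refine ⟨U ∩ V, hU.inter hV, ?_⟩
    funext t
    by_cases h1 : t ∈ U <;> by_cases h2 : t ∈ V <;> simp [h1, h2]
  algebraMap_mem' := fun r => by
    have h1 : (fun _ => (1 : ℂ)) ∈ Submodule.span ℂ (clopenCharFns T) :=
      Submodule.subset_span ⟨Set.univ, isClopen_univ, by simp⟩
    have h2 := Submodule.smul_mem _ r h1
    have h3 : algebraMap ℂ (T → ℂ) r = r • (fun _ => (1 : ℂ)) := by
      funext t
      simp
    simpa only [SetLike.mem_coe, h3] using h2
  star_mem' := fun {a} ha => by
    simp only [SetLike.mem_coe] at ha ⊢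
    induction ha using Submodule.span_induction with
    | mem x hx =>
      obtain ⟨U, hU, rfl⟩ := hx
      refine Submodule.subset_span ⟨U, hU, ?_⟩
      funext t
      by_cases ht : t ∈ U <;> simp [ht]
    | zero => simp
    | add x y _ _ hx hy => rw [star_add]; exact Submodule.add_mem _ hx hy
    | smul c x _ hx => rw [star_smul]; exact Submodule.smul_mem _ _ hx

/-! From (i) to (ii), the annihilator of `0` supplies a unit, and algebraicity makes `B` integral
over `ℂ`. Every residue ring at a prime is then `ℂ`, so elements become functions on the prime
spectrum, with finite range because their values are roots of a minimal polynomial. The Baer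
condition does the rest: it excludes nilpotents, so the representation is faithful; it makes
idempotents self-adjoint, so the involution becomes conjugation; and it makes the closure of an open
set the zero locus of a projection, hence open (`extremallyDisconnected_of_isBaerStarRing`).
Conversely, functions in the span are integral, and annihilators are cut out by clopen sets
(`isBaerStarRing_clopenSpan`). -/

/-! ### The algebra spanned by clopen indicators -/

section ClopenSpan

variable {T : Type*} [TopologicalSpace T]

theorem mem_clopenSpan_iff {g : T → ℂ} :
    g ∈ clopenSpan T ↔ g ∈ Submodule.span ℂ (clopenCharFns T) :=
  Iff.rfl

theorem indicator_mem_clopenSpan {U : Set T} (hU : IsClopen U) :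
    U.indicator (fun _ => (1 : ℂ)) ∈ clopenSpan T :=
  Submodule.subset_span ⟨U, hU, rfl⟩

theorem continuous_of_mem_clopenSpan {g : T → ℂ} (hg : g ∈ clopenSpan T) : Continuous g := by
  rw [mem_clopenSpan_iff] at hg
  induction hg using Submodule.span_induction with
  | mem x hx =>
    obtain ⟨U, hU, rfl⟩ := hx
    exact continuous_const.indicator (by simp [hU.frontier_eq])
  | zero => exact continuous_const
  | add x y _ _ hx hy => exact hx.add hy
  | smul c x _ hx => exact hx.const_smul c

theorem isIntegral_of_mem_clopenSpan {g : T → ℂ} (hg : g ∈ clopenSpan T) : IsIntegral ℂ g := by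
  rw [mem_clopenSpan_iff] at hg
  induction hg using Submodule.span_induction with
  | mem x hx =>
    obtain ⟨U, hU, rfl⟩ := hx
    refine ⟨Polynomial.X ^ 2 - Polynomial.X, by monicity!, ?_⟩
    funext t
    by_cases ht : t ∈ U <;> simp [ht]
  | zero => exact isIntegral_zero
  | add x y _ _ hx hy => exact hx.add hy
  | smul c x _ hx => exact hx.smul c

/-- A locally constant function with finite range is a linear combination of characteristic
functions of clopen sets. -/
theorem mem_clopenSpan_of_finite_range {g : T → ℂ} (hg : IsLocallyConstant g)
    (hfin : (Set.range g).Finite) : g ∈ clopenSpan T := by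
  have h : g = ∑ c ∈ hfin.toFinset, c • (g ⁻¹' {c}).indicator (fun _ => (1 : ℂ)) := by
    funext t
    rw [Finset.sum_apply, Finset.sum_eq_single (g t)]
    · simp
    · intro c _ hc
      simp [Set.indicator, hc.symm]
    · intro ht
      exact absurd (hfin.mem_toFinset.2 ⟨t, rfl⟩) ht
  rw [h, mem_clopenSpan_iff]
  exact Submodule.sum_mem _ fun c _ => Submodule.smul_mem _ _
    (Submodule.subset_span ⟨_, hg.isClopen_fiber c, rfl⟩)

theorem isBaerStarRing_clopenSpan [ExtremallyDisconnected T] : IsBaerStarRing (clopenSpan T) := by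
  intro S _
  set V : Set T := ⋃ a ∈ S, {t | (a : T → ℂ) t ≠ 0} with hV
  have hVo : IsOpen V := isOpen_biUnion fun a _ =>
    isOpen_ne_fun (continuous_of_mem_clopenSpan a.2) continuous_const
  -- A function annihilating `S` vanishes on `V`, hence by continuity on its closure; the indicator
  -- of the complement is the projection sought.
  have hW : IsClopen (closure V)ᶜ :=
    IsClopen.compl ⟨isClosed_closure, ExtremallyDisconnected.open_closure V hVo⟩
  refine ⟨⟨_, indicator_mem_clopenSpan hW⟩, ⟨?_, ?_⟩, ?_⟩
  · apply Subtype.ext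
    funext t
    by_cases ht : t ∈ closure V <;> simp [ht]
  · apply Subtype.ext
    funext t
    by_cases ht : t ∈ closure V <;> simp [ht]
  · ext y
    constructor
    · intro hy
      have hzero : ∀ t ∈ closure V, (y : T → ℂ) t = 0 := by
        have hsub : closure V ⊆ {t | (y : T → ℂ) t = 0} := by
          refine closure_minimal ?_
            (isClosed_eq (continuous_of_mem_clopenSpan y.2) continuous_const)
          intro t ht
          simp only [hV, Set.mem_iUnion, Set.mem_ofPred_eq, exists_prop] at ht
          obtain ⟨a, ha, hat⟩ := ht
          have := congrFun (congrArg Subtype.val (hy a ha)) t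
          exact (mul_eq_zero.1 this).resolve_left hat
        exact fun t ht => hsub ht
      refine ⟨y, Subtype.ext (funext fun t => ?_)⟩
      by_cases ht : t ∈ closure V
      · simp [ht, hzero t ht]
      · simp [ht]
    · rintro ⟨z, rfl⟩ a ha
      refine Subtype.ext (funext fun t => ?_)
      by_cases hat : (a : T → ℂ) t = 0
      · simp [hat]
      · have ht : t ∈ closure V := subset_closure (Set.mem_biUnion ha hat)
        simp [ht]

end ClopenSpan

/-! ### Transfer along `*`-isomorphisms -/

section Transfer

variable {A C : Type*} [NonUnitalRing A] [StarRing A] [Module ℂ A]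
  [NonUnitalRing C] [StarRing C] [Module ℂ C]

theorem IsBaerStarRing.of_starAlgEquiv (e : A ≃⋆ₐ[ℂ] C) (hC : IsBaerStarRing C) :
    IsBaerStarRing A := by
  intro S hS
  obtain ⟨f, hf, hann⟩ := hC (e '' S) (hS.image e)
  refine ⟨e.symm f, ⟨?_, ?_⟩, ?_⟩
  · rw [IsIdempotentElem, ← map_mul, hf.isIdempotentElem.eq]
  · rw [IsSelfAdjoint, ← map_star, hf.isSelfAdjoint.star_eq]
  · ext y
    have h : y ∈ rightAnnihilator S ↔ e y ∈ rightAnnihilator (e '' S) := by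
      simp only [rightAnnihilator, Set.mem_ofPred_eq, Set.forall_mem_image, ← map_mul,
        EmbeddingLike.map_eq_zero_iff]
    rw [h, hann]
    constructor
    · rintro ⟨z, hz⟩
      refine ⟨e.symm z, ?_⟩
      simp only at hz ⊢
      rw [← map_mul, hz, StarAlgEquiv.symm_apply_apply]
    · rintro ⟨z, rfl⟩
      exact ⟨e z, by simp⟩

end Transfer

theorem isAlgebraicAlgebra_of_starAlgEquiv_clopenSpan {A T : Type*} [NonUnitalRing A] [StarRing A]
    [Module ℂ A] [IsScalarTower ℂ A A] [SMulCommClass ℂ A A] [TopologicalSpace T]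
    (e : A ≃⋆ₐ[ℂ] clopenSpan T) : IsAlgebraicAlgebra A := by
  intro a
  have : FiniteDimensional ℂ (Algebra.adjoin ℂ {(e a : T → ℂ)}) :=
    Module.Finite.iff_fg.2 (isIntegral_of_mem_clopenSpan (e a).2).fg_adjoin_singleton
  have hmem : ∀ b ∈ NonUnitalAlgebra.adjoin ℂ ({a} : Set A),
      (e b : T → ℂ) ∈ Algebra.adjoin ℂ {(e a : T → ℂ)} := by
    intro b hb
    induction hb using NonUnitalAlgebra.adjoin_induction with
    | mem x hx =>
      obtain rfl := Set.mem_singleton_iff.1 hx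
      exact Algebra.self_mem_adjoin_singleton ℂ _
    | add x y _ _ hx hy => rw [map_add]; exact add_mem hx hy
    | zero => rw [map_zero]; exact zero_mem _
    | mul x y _ _ hx hy => rw [map_mul]; exact mul_mem hx hy
    | smul r x _ hx => rw [map_smul]; exact Subalgebra.smul_mem _ hx r
  let F : NonUnitalAlgebra.adjoin ℂ ({a} : Set A) →ₗ[ℂ] Algebra.adjoin ℂ {(e a : T → ℂ)} :=
    { toFun := fun b => ⟨(e b : T → ℂ), hmem b b.2⟩
      map_add' := fun x y => Subtype.ext (by simp)
      map_smul' := fun r x => Subtype.ext (by simp) }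
  refine Module.Finite.of_injective F fun x y hxy => ?_
  have h : (e x : T → ℂ) = e y :=
    congrArg (fun z : Algebra.adjoin ℂ {(e a : T → ℂ)} => (z : T → ℂ)) hxy
  exact Subtype.ext (e.injective (Subtype.ext h))

/-! ### Commutative Baer `*`-rings -/

section CommutativeBaer

variable {B : Type*} [NonUnitalCommRing B] [StarRing B]

theorem IsBaerStarRing.exists_one (hB : IsBaerStarRing B) : ∃ u : B, ∀ b, u * b = b := by
  obtain ⟨f, hf, hann⟩ := hB {0} (Set.singleton_nonempty 0)
  refine ⟨f, fun b => ?_⟩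
  have hb : b ∈ rightAnnihilator ({0} : Set B) := by simp [rightAnnihilator]
  rw [hann] at hb
  obtain ⟨z, rfl⟩ := hb
  simp only [← mul_assoc, hf.isIdempotentElem.eq]

/-- By commutativity `star a` annihilates `a`, so `f * star a = star a`; taking adjoints gives `a =
a * f = 0`. -/
theorem IsBaerStarRing.eq_zero_of_star_mul_self (hB : IsBaerStarRing B) {a : B}
    (ha : star a * a = 0) : a = 0 := by
  obtain ⟨f, hf, hann⟩ := hB {a} (Set.singleton_nonempty a)
  have hmem : star a ∈ rightAnnihilator ({a} : Set B) := by
    simpa [rightAnnihilator, mul_comm] using ha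
  have hfm : f ∈ rightAnnihilator ({a} : Set B) := by
    rw [hann]
    exact ⟨f, hf.isIdempotentElem.eq⟩
  rw [hann] at hmem
  obtain ⟨z, hz⟩ := hmem
  have hfa : f * star a = star a := by
    simp only [← hz, ← mul_assoc, hf.isIdempotentElem.eq]
  have haf : a * f = 0 := hfm a rfl
  have h := congrArg star hfa
  rw [star_mul, star_star, hf.isSelfAdjoint.star_eq, haf] at h
  exact h.symm

/-- Properness of the involution, applied to `e - star e * e`, exhibits `e` as the self-adjoint
element `star e * e`. -/
theorem IsBaerStarRing.star_eq_of_isIdempotentElem (hB : IsBaerStarRing B) {e : B}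
    (he : IsIdempotentElem e) : star e = e := by
  have hs : star e * star e = star e := by rw [← star_mul, he.eq]
  have h : e - star e * e = 0 := by
    apply hB.eq_zero_of_star_mul_self
    have he' := he.eq
    rw [star_sub, star_mul, star_star, sub_mul, mul_sub, mul_sub]
    have h1 : star e * (star e * e) = star e * e := by rw [← mul_assoc, hs]
    have h2 : star e * e * e = star e * e := by rw [mul_assoc, he']
    have h3 : star e * e * (star e * e) = star e * e := by
      rw [mul_assoc, ← mul_assoc e, mul_comm e (star e), h2, h1]
    rw [h1, h2, h3]
    simp
  have h' : e = star e * e := sub_eq_zero.1 h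
  conv_lhs => rw [h', star_mul, star_star]
  exact h'.symm

theorem IsBaerStarRing.eq_zero_of_mul_self (hB : IsBaerStarRing B) {a : B} (ha : a * a = 0) :
    a = 0 := by
  apply hB.eq_zero_of_star_mul_self
  apply hB.eq_zero_of_star_mul_self
  rw [star_mul, star_star, mul_assoc, mul_left_comm a, ha, mul_zero, mul_zero]

end CommutativeBaer

theorem IsBaerStarRing.isReduced {B : Type*} [CommRing B] [StarRing B] (hB : IsBaerStarRing B) :
    IsReduced B :=
  (isReduced_iff_pow_one_lt 2 one_lt_two).2 fun a ha =>
    hB.eq_zero_of_mul_self (by rwa [← pow_two])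

theorem IsAlgebraicAlgebra.isIntegral {B : Type*} [CommRing B] [Algebra ℂ B]
    (hB : IsAlgebraicAlgebra B) : Algebra.IsIntegral ℂ B where
  isIntegral a := by
    have := hB a
    let N := (NonUnitalAlgebra.adjoin ℂ ({a} : Set B)).toSubmodule
    have ha : a ∈ NonUnitalAlgebra.adjoin ℂ ({a} : Set B) :=
      NonUnitalAlgebra.self_mem_adjoin_singleton ℂ a
    have hpow : ∀ n : ℕ, a ^ (n + 1) ∈ NonUnitalAlgebra.adjoin ℂ ({a} : Set B) := by
      intro n
      induction n with
      | zero => rwa [zero_add, pow_one]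
      | succ n ih =>
        rw [pow_succ]
        exact mul_mem ih ha
    have hNfg : N.FG := Module.Finite.iff_fg.1 this
    -- Only the zeroth power of `a` can fall outside the nonunital subalgebra.
    have hle : Subalgebra.toSubmodule (Algebra.adjoin ℂ {a}) ≤ ℂ ∙ (1 : B) ⊔ N := by
      rw [Algebra.adjoin_eq_span, Submodule.span_le]
      intro x hx
      obtain ⟨n, rfl⟩ := Submonoid.mem_closure_singleton.1 hx
      rcases n with _ | n
      · rw [pow_zero]
        exact Submodule.mem_sup_left (Submodule.mem_span_singleton_self 1)
      · exact Submodule.mem_sup_right (hpow n)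
    have hfg : (ℂ ∙ (1 : B) ⊔ N).FG := (Submodule.fg_span_singleton 1).sup hNfg
    exact IsIntegral.of_mem_of_fg _ (hfg.of_le hle) a (Algebra.self_mem_adjoin_singleton ℂ a)

/-! ### Characters and the topology of the prime spectrum -/

namespace PrimeSpectrum

section Evaluation

variable {B : Type*} [CommRing B] [Algebra ℂ B] [Algebra.IsIntegral ℂ B]

theorem algebraMap_quotient_bijective (p : PrimeSpectrum B) :
    Function.Bijective (algebraMap ℂ (B ⧸ p.asIdeal)) :=
  IsAlgClosed.algebraMap_bijective_of_isIntegral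

/-- The complex character of an integral commutative `ℂ`-algebra with a given prime kernel. -/
noncomputable def character (p : PrimeSpectrum B) : B →ₐ[ℂ] ℂ :=
  ((AlgEquiv.ofBijective (Algebra.ofId ℂ (B ⧸ p.asIdeal))
    (algebraMap_quotient_bijective p)).symm : (B ⧸ p.asIdeal) →ₐ[ℂ] ℂ).comp
      (Ideal.Quotient.mkₐ ℂ p.asIdeal)

theorem character_eq_zero_iff {p : PrimeSpectrum B} {a : B} :
    character p a = 0 ↔ a ∈ p.asIdeal := by
  simp [character, Ideal.Quotient.eq_zero_iff_mem]

variable (B) in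
/-- The representation of an integral commutative `ℂ`-algebra by complex functions on its prime
spectrum. -/
noncomputable def evaluation : B →ₐ[ℂ] (PrimeSpectrum B → ℂ) :=
  AlgHom.pi character

@[simp]
theorem evaluation_apply (a : B) (p : PrimeSpectrum B) : evaluation B a p = character p a :=
  rfl

theorem evaluation_injective [IsReduced B] : Function.Injective (evaluation B) := by
  rw [injective_iff_map_eq_zero]
  intro a ha
  rw [← isNilpotent_iff_eq_zero, nilpotent_iff_mem_prime]
  exact fun J hJ => character_eq_zero_iff.1 (congrFun ha ⟨J, hJ⟩)

theorem evaluation_idempotent {e : B} (he : IsIdempotentElem e) :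
    evaluation B e = (basicOpen e : Set (PrimeSpectrum B)).indicator (fun _ => (1 : ℂ)) := by
  funext p
  have hp : IsIdempotentElem (character p e) := he.map _
  by_cases h : e ∈ p.asIdeal
  · simp [h, character_eq_zero_iff.2 h]
  · have := (IsIdempotentElem.iff_eq_zero_or_one.1 hp).resolve_left
      (mt character_eq_zero_iff.1 h)
    simp [h, this]

theorem finite_range_evaluation (a : B) : (Set.range (evaluation B a)).Finite := by
  refine (((minpoly ℂ a).rootSet_finite ℂ)).subset ?_
  rintro _ ⟨p, rfl⟩
  rw [Polynomial.mem_rootSet]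
  refine ⟨minpoly.ne_zero (Algebra.IsIntegral.isIntegral a), ?_⟩
  rw [evaluation_apply, Polynomial.aeval_algHom_apply, minpoly.aeval, map_zero]

/-- Fibres are closed and only finitely many are nonempty, so every preimage is the complement of a
finite union of closed sets. -/
theorem isLocallyConstant_evaluation (a : B) : IsLocallyConstant (evaluation B a) := by
  have hclosed : ∀ c : ℂ, IsClosed (evaluation B a ⁻¹' {c}) := by
    intro c
    have : evaluation B a ⁻¹' {c} = zeroLocus {a - algebraMap ℂ B c} := by
      ext p
      simp [← character_eq_zero_iff, sub_eq_zero]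
    rw [this]
    exact isClosed_zeroLocus _
  intro s
  have hs : evaluation B a ⁻¹' s =
      (⋃ c ∈ Set.range (evaluation B a) ∩ sᶜ, evaluation B a ⁻¹' {c})ᶜ := by
    ext p
    simp only [Set.mem_preimage, Set.mem_compl_iff, Set.mem_iUnion, Set.mem_inter_iff,
      Set.mem_singleton_iff, exists_prop, exists_eq_right', Set.mem_range_self, true_and,
      not_not]
  rw [hs, isOpen_compl_iff]
  exact ((finite_range_evaluation a).inter_of_left _).isClosed_biUnion fun c _ => hclosed c

theorem evaluation_mem_clopenSpan (a : B) : evaluation B a ∈ clopenSpan (PrimeSpectrum B) :=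
  mem_clopenSpan_of_finite_range (isLocallyConstant_evaluation a) (finite_range_evaluation a)

variable (B) in
theorem t2Space_of_isIntegral : T2Space (PrimeSpectrum B) := by
  refine ⟨fun p q hpq => ?_⟩
  obtain ⟨a, ha⟩ : ∃ a, evaluation B a p ≠ evaluation B a q := by
    by_contra! h
    refine hpq (PrimeSpectrum.ext (Ideal.ext fun a => ?_))
    rw [← character_eq_zero_iff, ← character_eq_zero_iff, ← evaluation_apply, h,
      evaluation_apply]
  have hlc := isLocallyConstant_evaluation a
  exact ⟨_, _, hlc.isOpen_fiber _, hlc.isOpen_fiber _, rfl, rfl,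
    Set.disjoint_left.2 fun x hp hq => ha (Eq.trans (Eq.symm hp) hq)⟩

end Evaluation

theorem extremallyDisconnected_of_isBaerStarRing {B : Type*} [CommRing B] [StarRing B]
    [IsReduced B] (hB : IsBaerStarRing B) : ExtremallyDisconnected (PrimeSpectrum B) where
  open_closure U hU := by
    -- The projection `f` is killed by `S`, so it vanishes on `U`. Conversely, any `g` whose basic
    -- open set misses the closure annihilates `S`, so it lies in `fB` and vanishes wherever `f`
    -- does.
    set S : Set B := {a | (basicOpen a : Set (PrimeSpectrum B)) ⊆ U} with hS
    obtain ⟨f, hf, hann⟩ := hB S ⟨0, by simp [hS]⟩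
    have hcl : closure U = zeroLocus {f} := by
      apply subset_antisymm
      · refine closure_minimal ?_ (isClosed_zeroLocus _)
        intro p hp
        obtain ⟨_, ⟨a, rfl⟩, hpa, haU⟩ :=
          isTopologicalBasis_basic_opens.exists_subset_of_mem_open hp hU
        have haf : a * f = 0 := by
          have : f ∈ rightAnnihilator S := by
            rw [hann]
            exact ⟨f, hf.isIdempotentElem.eq⟩
          exact this a haU
        have : a * f ∈ p.asIdeal := haf ▸ zero_mem _
        simpa using (p.isPrime.mem_or_mem this).resolve_left hpa
      · intro p hp
        by_contra hpU
        obtain ⟨_, ⟨g, rfl⟩, hpg, hgU⟩ :=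
          isTopologicalBasis_basic_opens.exists_subset_of_mem_open
            (show p ∈ (closure U)ᶜ from hpU) isClosed_closure.isOpen_compl
        have hg : g ∈ rightAnnihilator S := by
          intro a ha
          rw [← isNilpotent_iff_eq_zero, ← basicOpen_eq_bot_iff, basicOpen_mul]
          refine TopologicalSpace.Opens.ext (Set.eq_empty_of_forall_notMem ?_)
          rintro q ⟨hqa, hqg⟩
          exact hgU hqg (subset_closure (ha hqa))
        rw [hann] at hg
        obtain ⟨z, rfl⟩ := hg
        exact hpg (p.asIdeal.mul_mem_right z (by simpa using hp))
    rw [hcl]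
    exact (isClopen_iff_zeroLocus.2 ⟨f, hf.isIdempotentElem, rfl⟩).isOpen

end PrimeSpectrum

/-! ### The `*`-isomorphism and the equivalence -/

section Representation

open PrimeSpectrum

variable {B : Type*} [CommRing B] [Algebra ℂ B] [Algebra.IsIntegral ℂ B] [StarRing B]
  [StarModule ℂ B]

/-- Clopen sets come from idempotents, which are self-adjoint. Carrying the star through the span
induction yields surjectivity and, by injectivity, compatibility with the involution. -/
theorem IsBaerStarRing.exists_evaluation_eq (hB : IsBaerStarRing B) {g : PrimeSpectrum B → ℂ}
    (hg : g ∈ clopenSpan (PrimeSpectrum B)) :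
    ∃ b, evaluation B b = g ∧ evaluation B (star b) = star g := by
  rw [mem_clopenSpan_iff] at hg
  induction hg using Submodule.span_induction with
  | mem x hx =>
    obtain ⟨U, hU, rfl⟩ := hx
    obtain ⟨e, he, rfl⟩ := PrimeSpectrum.isClopen_iff.1 hU
    refine ⟨e, evaluation_idempotent he, ?_⟩
    rw [hB.star_eq_of_isIdempotentElem he, evaluation_idempotent he]
    funext p
    by_cases hp : e ∈ p.asIdeal <;> simp [hp]
  | zero => exact ⟨0, by simp⟩
  | add x y _ _ hx hy =>
    obtain ⟨a, rfl, ha⟩ := hx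
    obtain ⟨b, rfl, hb⟩ := hy
    exact ⟨a + b, map_add _ _ _, by rw [star_add, map_add, ha, hb, star_add]⟩
  | smul c x _ hx =>
    obtain ⟨a, rfl, ha⟩ := hx
    exact ⟨c • a, map_smul _ _ _, by rw [star_smul, map_smul, ha, star_smul]⟩

theorem IsBaerStarRing.nonempty_starAlgEquiv_clopenSpan (hB : IsBaerStarRing B) :
    Nonempty (B ≃⋆ₐ[ℂ] clopenSpan (PrimeSpectrum B)) := by
  have := hB.isReduced
  let F : B →⋆ₐ[ℂ] clopenSpan (PrimeSpectrum B) :=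
    { (evaluation B).codRestrict (clopenSpan (PrimeSpectrum B)).toSubalgebra
        evaluation_mem_clopenSpan with
      map_star' := fun a => by
        obtain ⟨b, hb, hbs⟩ := hB.exists_evaluation_eq (evaluation_mem_clopenSpan a)
        obtain rfl := evaluation_injective hb
        exact Subtype.ext hbs }
  refine ⟨StarAlgEquiv.ofBijective F ⟨fun a b hab => ?_, fun g => ?_⟩⟩
  · exact evaluation_injective (congrArg Subtype.val hab)
  · obtain ⟨b, hb, -⟩ := hB.exists_evaluation_eq g.2
    exact ⟨b, Subtype.ext hb⟩

end Representation

theorem exists_stonean_of_isBaerStarRing {B : Type u} [CommRing B] [Algebra ℂ B] [StarRing B]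
    [StarModule ℂ B] (hint : IsAlgebraicAlgebra B) (hB : IsBaerStarRing B) :
    ∃ T : Stonean.{u}, Nonempty (B ≃⋆ₐ[ℂ] clopenSpan T) := by
  have := hint.isIntegral
  have := hB.isReduced
  have := PrimeSpectrum.t2Space_of_isIntegral B
  have := PrimeSpectrum.extremallyDisconnected_of_isBaerStarRing hB
  exact ⟨Stonean.of (PrimeSpectrum B), hB.nonempty_starAlgEquiv_clopenSpan⟩

/-- The unital ring structure on a nonunital commutative ring given by an identity element. -/
abbrev NonUnitalCommRing.toCommRingOfOne {B : Type*} [inst : NonUnitalCommRing B] (u : B)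
    (hu : ∀ b, u * b = b) : CommRing B :=
  { inst with
    one := u
    one_mul := hu
    mul_one := fun b => (mul_comm b u).trans (hu b) }

theorem theorem3p5 {B : Type u} [NonUnitalCommRing B] [Module ℂ B] [IsScalarTower ℂ B B]
    [SMulCommClass ℂ B B] [StarRing B] [StarModule ℂ B] :
    (IsAlgebraicAlgebra B ∧ IsBaerStarRing B) ↔
      ∃ T : Stonean.{u}, Nonempty (B ≃⋆ₐ[ℂ] clopenSpan T) := by
  constructor
  · rintro ⟨halg, hB⟩
    obtain ⟨u, hu⟩ := hB.exists_one
    let _ : CommRing B := NonUnitalCommRing.toCommRingOfOne u hu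
    let _ : Algebra ℂ B := Algebra.ofModule smul_mul_assoc mul_smul_comm
    -- The added unit leaves the nonunital operations definitionally unchanged, so both hypotheses
    -- apply as they are.
    exact exists_stonean_of_isBaerStarRing halg hB
  · rintro ⟨T, ⟨e⟩⟩
    exact ⟨isAlgebraicAlgebra_of_starAlgEquiv_clopenSpan e,
      IsBaerStarRing.of_starAlgEquiv e isBaerStarRing_clopenSpan⟩
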